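/- **Proposition 2.1.** Let $G$ be a non-elementary (that is, not virtually cyclic) Gromov-hyperbolic group with a finite symmetric generating set $S$, and let $\Gamma$ be the Cayley graph of $(G,S)$, with word metric $d$ and edge set $E$. Let $\rho$ be a probability measure on $[0,\infty)$ without atoms such that $\int_0^\infty e^{ax}\,d\rho(x)<\infty$ for some $a>0$, and let $\mathbb P=\rho^{\otimes E}$ on $\Omega=[0,\infty)^E$. For $\omega\in\Omega$ let $d_\omega(x,y)=\inf_{\gamma:x\to y}\sum_{e\in\gamma}\omega(e)$, the infimum being over edge paths $\gamma$ in $\Gamma$ from $x$ to $y$; an $\omega$-geodesic from $x$ to $y$ is an edge path attaining this infimum, and a word geodesic from $x$ to $y$ is an edge path with exactly $d(x,y)$ edges. For $o\in G$ and $r\ge 0$ let $N_r(o)$ be the set of vertices at word distance at most $r$ from $o$. Fix $o\in G$ and $C>0$. For $\omega\in\Omega$ let $R(\omega)\in\{0,1,2,\dots\}\cup\{\infty\}$ be the smallest integer $R\ge 0$ such that for all $x,y\in G$ for which some word geodesic from $x$ to $y$ meets $N_C(o)$, there is an $\omega$-geodesic from $x$ to $y$ and every such $\omega$-geodesic meets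 $N_R(o)$; put $R(\omega)=\infty$ if no such $R$ exists. Then there exist $c>0$ and $N_0\in\mathbb N$ such that $$\mathbb P[R(\omega)\ge N]\le e^{-cN}\qquad\text{for all integers } N\ge N_0.$$ -/

import Mathlib

open scoped NNReal ENNReal

noncomputable section

namespace FPP

variable {V : Type*} (Γ : SimpleGraph V)

/-- A word geodesic: a path realising the graph (word) distance between its endpoints. -/
def IsWordGeodesic {Γ : SimpleGraph V} {x y : V} (p : Γ.Walk x y) : Prop :=
  p.length = Γ.dist x y

/-- The path `p` meets the closed `r`-neighbourhood of `o` in the graph metric. -/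
def Meets {Γ : SimpleGraph V} {x y : V} (p : Γ.Walk x y) (o : V) (r : ℝ) : Prop :=
  ∃ v ∈ p.support, (Γ.dist o v : ℝ) ≤ r

/-- Gromov hyperbolicity of a connected graph: there is a `δ` such that in every geodesic triangle
each side lies in the `δ`-neighbourhood of the union of the other two sides. -/
def IsGromovHyperbolic : Prop :=
  Γ.Connected ∧ ∃ δ : ℕ, ∀ (x y z : V) (p : Γ.Walk x y) (q : Γ.Walk y z) (r : Γ.Walk x z),
    IsWordGeodesic p → IsWordGeodesic q → IsWordGeodesic r →
      ∀ v ∈ r.support, ∃ w, (w ∈ p.support ∨ w ∈ q.support) ∧ Γ.dist v w ≤ δ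

/-- The configuration space `[0, ∞)^E`. -/
abbrev Config : Type _ := Γ.edgeSet → ℝ≥0

/-- The law `ρ^{⊗E}` of i.i.d. edge lengths with common distribution `ρ`. -/
def law (ρ : MeasureTheory.Measure ℝ≥0) [MeasureTheory.IsProbabilityMeasure ρ] :
    MeasureTheory.Measure (Config Γ) :=
  MeasureTheory.Measure.infinitePi fun _ : Γ.edgeSet => ρ

variable {Γ}

/-- The `ω`-length `∑_{e ∈ γ} ω(e)` of a path (edges counted as often as they are traversed). -/
def passageTime (ω : Config Γ) {x y : V} (p : Γ.Walk x y) : ℝ≥0 :=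
  (p.darts.map fun d => ω ⟨d.edge, d.edge_mem⟩).sum

/-- The first passage metric `d_ω(x, y)`, the infimum of the `ω`-lengths of the paths
from `x` to `y`. -/
def fppDist (ω : Config Γ) (x y : V) : ℝ≥0 :=
  ⨅ p : Γ.Walk x y, passageTime ω p

/-- An `ω`-geodesic: a path whose `ω`-length is the first passage distance of its endpoints. -/
def IsOmegaGeodesic (ω : Config Γ) {x y : V} (p : Γ.Walk x y) : Prop :=
  passageTime ω p = fppDist ω x y

/-- The radius `R` works for `ω`: for all `x, y` for which some word geodesic `[x, y]` meets
`N_C(o)`, the `ω`-geodesic `[x, y]_ω` meets `N_R(o)`. As `ω`-geodesics exist and are unique only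
for almost every `ω`, this asks that there is an `ω`-geodesic from `x` to `y` and that each of
them meets `N_R(o)`. -/
def GoodRadius (o : V) (C : ℝ) (ω : Config Γ) (R : ℕ) : Prop :=
  ∀ x y : V, (∃ p : Γ.Walk x y, IsWordGeodesic p ∧ Meets p o C) →
    (∃ q : Γ.Walk x y, IsOmegaGeodesic ω q) ∧
      ∀ q : Γ.Walk x y, IsOmegaGeodesic ω q → Meets q o R

/-- The smallest integer radius `R(ω)` that works for `ω`, with value `∞` if there is none. -/
def radius (o : V) (C : ℝ) (ω : Config Γ) : ℕ∞ :=
  sInf {R : ℕ∞ | ∃ n : ℕ, R = n ∧ GoodRadius o C ω n}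

end FPP

/-- `S` is a finite symmetric generating set of `G`, the Cayley graph of `(G, S)` is
Gromov hyperbolic, and `G` is non-elementary, that is, not virtually cyclic. -/
structure IsNonelementaryHyperbolic (G : Type*) [Group G] (S : Finset G) : Prop where
  generates : Subgroup.closure (S : Set G) = ⊤
  symmetric : ∀ s ∈ S, s⁻¹ ∈ S
  hyperbolic : FPP.IsGromovHyperbolic (SimpleGraph.mulCayley (S : Set G))
  nonelementary : ¬ ∃ H : Subgroup G, IsCyclic H ∧ H.FiniteIndex

end

noncomputable section

namespace FPP

/-! ### Hyperbolic geometry: detours around a point of a geodesic are exponentially long -/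

section Geometry

variable {V : Type*} {Γ : SimpleGraph V}

/-! Let `p` be a point of a word geodesic from `x` to `y` with `p` near `o`. By thin triangles, a
walk from `x` to `y` that avoids a large ball about `o` contains a subwalk whose endpoints lie
within `5s/4` of `p` but whose length is exponential in `s` (`exists_long_subwalk`), hence at least
`Ms` once `s` is large.

Such a detour cannot be `ω`-geodesic for typical `ω`. The exponential moment gives `K` such that,
with probability at least `1 - e^{-n}`, all points of `N_{2n}(o)` are within `ω`-distance `Kn` of
each other (`exists_law_slowEvent_le`). Since `ρ` has no mass at `0`, some `M` depending on `K`
makes all self-avoiding paths of `Mn` edges starting in `N_{2n}(o)` longer than `Kn`, with the same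
probability (`exists_law_fastEvent_le`). If neither exceptional event occurs at any scale `n ≥ n₀`,
then `ω`-geodesics exist and must pass near `o` (`goodRadius_of_notMem_events`). Taking `n₀`
proportional to `N` and summing the geometric series over `n ≥ n₀` gives the tail bound; only
monotonicity and subadditivity are needed for the exceptional events, so their measurability plays
no role. -/

theorem exists_eq_append_of_le {x y : V} (p : Γ.Walk x y) (m : ℕ) (hm : m ≤ p.length) :
    ∃ (z : V) (a : Γ.Walk x z) (b : Γ.Walk z y), a.length = m ∧ p = a.append b := by
  induction p generalizing m with
  | nil => exact ⟨_, .nil, .nil, by simp_all, rfl⟩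
  | @cons u v w h p ih =>
    cases m with
    | zero => exact ⟨_, .nil, .cons h p, rfl, rfl⟩
    | succ m =>
      obtain ⟨z, a, b, ha, rfl⟩ := ih m (by simpa using hm)
      exact ⟨z, .cons h a, b, by simp [ha], rfl⟩

/-- The thin-triangle condition with constant `δ`. -/
def IsSlim (Γ : SimpleGraph V) (δ : ℕ) : Prop :=
  ∀ (x y z : V) (p : Γ.Walk x y) (q : Γ.Walk y z) (r : Γ.Walk x z),
    IsWordGeodesic p → IsWordGeodesic q → IsWordGeodesic r →
      ∀ v ∈ r.support, ∃ w, (w ∈ p.support ∨ w ∈ q.support) ∧ Γ.dist v w ≤ δ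

/-- In a hyperbolic graph a geodesic stays logarithmically close to any walk with the same
endpoints. -/
theorem exists_dist_le_of_length_le_two_pow (hΓ : Γ.Connected) {δ : ℕ} (hδ : IsSlim Γ δ) (k : ℕ) :
    ∀ {x y : V} (c r : Γ.Walk x y), c.length ≤ 2 ^ k → IsWordGeodesic r →
      ∀ v ∈ r.support, ∃ w ∈ c.support, Γ.dist v w ≤ δ * k := by
  induction k with
  | zero =>
    intro x y c r hc hr v hv
    obtain ⟨a, b, rfl⟩ := SimpleGraph.Walk.mem_support_iff_exists_append.1 hv
    have hd := SimpleGraph.dist_le c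
    rw [IsWordGeodesic, SimpleGraph.Walk.length_append] at hr
    rcases Nat.eq_zero_or_pos a.length with ha | ha
    · obtain rfl := SimpleGraph.Walk.eq_of_length_eq_zero ha
      exact ⟨_, c.start_mem_support, by simp⟩
    · have hb : b.length = 0 := by omega
      obtain rfl := SimpleGraph.Walk.eq_of_length_eq_zero hb
      exact ⟨_, c.end_mem_support, by simp⟩
  | succ k ih =>
    intro x y c r hc hr v hv
    -- Halving the walk costs one thin triangle, so each doubling of the length adds `δ`.
    obtain ⟨z, a, b, ha, rfl⟩ := exists_eq_append_of_le c (min (2 ^ k) c.length) (by simp)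
    rw [SimpleGraph.Walk.length_append] at hc ha
    obtain ⟨p, hp⟩ := hΓ.exists_walk_length_eq_dist x z
    obtain ⟨q, hq⟩ := hΓ.exists_walk_length_eq_dist z y
    obtain ⟨w, hw, hvw⟩ := hδ x z y p q r hp hq hr v hv
    have key : ∃ w' ∈ (a.append b).support, Γ.dist w w' ≤ δ * k := by
      rcases hw with hw | hw
      · obtain ⟨w', hw', h⟩ := ih a p (by omega) hp w hw
        exact ⟨w', by simp [SimpleGraph.Walk.mem_support_append_iff, hw'], h⟩
      · obtain ⟨w', hw', h⟩ := ih b q (by rw [pow_succ] at hc; omega) hq w hw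
        exact ⟨w', by simp [SimpleGraph.Walk.mem_support_append_iff, hw'], h⟩
    obtain ⟨w', hw', h⟩ := key
    refine ⟨w', hw', ?_⟩
    have := hΓ.dist_triangle (u := v) (v := w) (w := w')
    rw [Nat.mul_succ]
    omega

/-- Every walk whose end satisfies `Q` can be cut at its first vertex satisfying `Q`. -/
theorem exists_first_split (Q : V → Prop) {x y : V} (p : Γ.Walk x y) (hy : Q y) :
    ∃ (v : V) (a : Γ.Walk x v) (b : Γ.Walk v y), p = a.append b ∧ Q v ∧
      ∀ z ∈ a.support, z = v ∨ ¬ Q z := by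
  induction p with
  | nil => exact ⟨_, .nil, .nil, rfl, hy, by simp⟩
  | @cons u w y h p ih =>
    by_cases hu : Q u
    · exact ⟨u, .nil, .cons h p, rfl, hu, by simp⟩
    · obtain ⟨v, a, b, rfl, hv, hz⟩ := ih hy
      refine ⟨v, .cons h a, b, rfl, hv, ?_⟩
      intro z hz'
      rw [SimpleGraph.Walk.support_cons, List.mem_cons] at hz'
      rcases hz' with rfl | hz'
      · exact .inr hu
      · exact hz z hz'

theorem exists_last_split (P : V → Prop) {x y : V} (p : Γ.Walk x y) (hx : P x) :
    ∃ (u : V) (a : Γ.Walk x u) (b : Γ.Walk u y), p = a.append b ∧ P u ∧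
      ∀ z ∈ b.support, z = u ∨ ¬ P z := by
  obtain ⟨u, a, b, h, hu, hz⟩ := exists_first_split P p.reverse hx
  refine ⟨u, b.reverse, a.reverse, ?_, hu, by simpa using hz⟩
  rw [← SimpleGraph.Walk.reverse_append, ← h, SimpleGraph.Walk.reverse_reverse]

/-- `z` lies in the cone of slope `1/4` with apex `p` around the geodesics from `p` to `x`. -/
def InCone (Γ : SimpleGraph V) (p x z : V) : Prop :=
  ∃ q, Γ.dist x q + Γ.dist q p = Γ.dist x p ∧ 4 * Γ.dist z q ≤ Γ.dist q p

theorem inCone_self (p x : V) : InCone Γ p x x :=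
  ⟨x, by simp, by simp⟩

/-- A walk between the two opposite cones that stays outside of them is exponentially long. -/
theorem le_of_walk_between_cones_aux (hΓ : Γ.Connected) {δ : ℕ} (hδ : IsSlim Γ δ)
    {a b p u v : V} (hab : Γ.dist a p + Γ.dist p b = Γ.dist a b)
    (hle : Γ.dist p b ≤ Γ.dist a p) (hu : 4 * Γ.dist u a ≤ Γ.dist a p)
    (hv : 4 * Γ.dist v b ≤ Γ.dist p b) (γ : Γ.Walk u v)
    (hγ : ∀ z ∈ γ.support, z = u ∨ z = v ∨
      ∀ q, Γ.dist a q + Γ.dist q p = Γ.dist a p → Γ.dist q p < 4 * Γ.dist z q)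
    {k : ℕ} (hk : Γ.dist a p + γ.length ≤ 2 ^ k) :
    Γ.dist a p ≤ 8 * δ * k + 1 := by
  obtain ⟨α, hα⟩ := hΓ.exists_walk_length_eq_dist a p
  -- `q` is the midpoint between `a` and `p`, up to rounding; it lies deep inside the cone region
  -- and far from both `a` and `b`.
  obtain ⟨q, α₁, α₂, h1, rfl⟩ := exists_eq_append_of_le α (Γ.dist a p - Γ.dist a p / 2)
    (by omega)
  rw [SimpleGraph.Walk.length_append] at hα
  have haq := SimpleGraph.dist_le α₁
  have hqp := SimpleGraph.dist_le α₂
  have t1 := hΓ.dist_triangle (u := a) (v := q) (w := p)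
  have t2 := hΓ.dist_triangle (u := q) (v := p) (w := b)
  have t3 := hΓ.dist_triangle (u := a) (v := q) (w := b)
  obtain ⟨β, hβ⟩ := hΓ.exists_walk_length_eq_dist q b
  obtain ⟨σ, hσ⟩ := hΓ.exists_walk_length_eq_dist a u
  obtain ⟨τ, hτ⟩ := hΓ.exists_walk_length_eq_dist v b
  rw [SimpleGraph.dist_comm (u := u)] at hu
  have hgeo : IsWordGeodesic (α₁.append β) := by
    rw [IsWordGeodesic, SimpleGraph.Walk.length_append]
    omega
  obtain ⟨w, hw, hqw⟩ := exists_dist_le_of_length_le_two_pow hΓ hδ k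
    (σ.append (γ.append τ)) (α₁.append β)
    (by simp only [SimpleGraph.Walk.length_append]; omega) hgeo q
    (by simp [SimpleGraph.Walk.mem_support_append_iff])
  -- The connecting pieces `σ` and `τ` stay close to `a` and `b`, and interior vertices of `γ` miss
  -- the cone around `q`; all are therefore at distance of order `d(a, p) / 8` or more from `q`.
  have far : Γ.dist a p ≤ 8 * Γ.dist q w + 1 := by
    have hσ' : w ∈ σ.support → Γ.dist a p ≤ 8 * Γ.dist q w + 1 := by
      intro hw
      obtain ⟨σ₁, σ₂, rfl⟩ := SimpleGraph.Walk.mem_support_iff_exists_append.1 hw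
      rw [SimpleGraph.Walk.length_append] at hσ
      have := SimpleGraph.dist_le σ₁
      have := hΓ.dist_triangle (u := a) (v := w) (w := q)
      rw [SimpleGraph.dist_comm (u := w)] at this
      omega
    have hτ' : w ∈ τ.support → Γ.dist a p ≤ 8 * Γ.dist q w + 1 := by
      intro hw
      obtain ⟨τ₁, τ₂, rfl⟩ := SimpleGraph.Walk.mem_support_iff_exists_append.1 hw
      rw [SimpleGraph.Walk.length_append] at hτ
      have := SimpleGraph.dist_le τ₂
      have := hΓ.dist_triangle (u := q) (v := w) (w := b)
      omega
    rw [SimpleGraph.Walk.mem_support_append_iff, SimpleGraph.Walk.mem_support_append_iff] at hw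
    rcases hw with hw | hw | hw
    · exact hσ' hw
    · rcases hγ w hw with rfl | rfl | h
      · exact hσ' σ.end_mem_support
      · exact hτ' τ.start_mem_support
      · have := h q (by omega)
        rw [SimpleGraph.dist_comm (u := w)] at this
        omega
    · exact hτ' hw
  have : 8 * δ * k = 8 * (δ * k) := by ring
  omega

/-- Let `p` be on a geodesic from `x` to `y`. Any walk `γ` from `x` to `y` has a subwalk whose
endpoints `u`, `v` are at distance `O(s)` of `p` and which is exponentially long in `s`, where `s`
is comparable to the distance of `u` or `v` to `p`. -/
theorem exists_long_subwalk (hΓ : Γ.Connected) {δ : ℕ} (hδ : IsSlim Γ δ) {x y p : V}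
    (hp : Γ.dist x p + Γ.dist p y = Γ.dist x y) (γ : Γ.Walk x y) :
    ∃ (u v : V) (a : Γ.Walk x u) (γ' : Γ.Walk u v) (b : Γ.Walk v y) (s : ℕ),
      γ = a.append (γ'.append b) ∧ 4 * Γ.dist p u ≤ 5 * s ∧ 4 * Γ.dist p v ≤ 5 * s ∧
      ∀ k, s + γ'.length ≤ 2 ^ k → s ≤ 8 * δ * k + 1 := by
  -- Cutting at the first entry into the cone towards `y`, then at the last earlier visit to the
  -- cone towards `x`, leaves a middle piece whose other vertices avoid both cones.
  obtain ⟨v, c, b, rfl, ⟨qv, hqv, hv⟩, hc⟩ := exists_first_split (InCone Γ p y) γ (inCone_self p y)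
  obtain ⟨u, a, γ', rfl, ⟨qu, hqu, hu⟩, hγ⟩ := exists_last_split (InCone Γ p x) c (inCone_self p x)
  have hout : ∀ z ∈ γ'.support, z = u ∨ z = v ∨ (¬ InCone Γ p x z ∧ ¬ InCone Γ p y z) := by
    intro z hz
    have h1 := hγ z hz
    have h2 := hc z (by simp [SimpleGraph.Walk.mem_support_append_iff, hz])
    tauto
  have t1 := hΓ.dist_triangle (u := p) (v := qu) (w := u)
  have t2 := hΓ.dist_triangle (u := p) (v := qv) (w := v)
  have t3 := hΓ.dist_triangle (u := x) (v := qu) (w := y)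
  have t4 := hΓ.dist_triangle (u := qu) (v := qv) (w := y)
  have t5 := hΓ.dist_triangle (u := qu) (v := p) (w := qv)
  have c1 := SimpleGraph.dist_comm (G := Γ) (u := p) (v := qu)
  have c2 := SimpleGraph.dist_comm (G := Γ) (u := p) (v := qv)
  have c3 := SimpleGraph.dist_comm (G := Γ) (u := u) (v := qu)
  have c4 := SimpleGraph.dist_comm (G := Γ) (u := v) (v := qv)
  have c5 := SimpleGraph.dist_comm (G := Γ) (u := y) (v := qv)
  have c6 := SimpleGraph.dist_comm (G := Γ) (u := p) (v := y)
  have c7 := SimpleGraph.dist_comm (G := Γ) (u := qu) (v := qv)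
  have hpos : ∀ (x' q z : V), ¬ InCone Γ p x' z → Γ.dist x' q + Γ.dist q p = Γ.dist x' p →
      Γ.dist q p < 4 * Γ.dist z q := by
    intro x' q z hz hq
    by_contra! hcon
    exact hz ⟨q, hq, hcon⟩
  -- The scale `s` is the larger of the two distances from `p` to `qu` and `qv`; the second case is
  -- the first one for the reversed walk.
  rcases le_total (Γ.dist p qv) (Γ.dist qu p) with hle | hle
  · refine ⟨u, v, a, γ', b, Γ.dist qu p, by rw [SimpleGraph.Walk.append_assoc], by omega,
      by omega, fun k hk => ?_⟩
    refine le_of_walk_between_cones_aux hΓ hδ (by omega) hle hu (by omega) γ' ?_ hk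
    intro z hz
    refine (hout z hz).imp_right (Or.imp_right fun h q hq => ?_)
    refine hpos x q z h.1 ?_
    have := hΓ.dist_triangle (u := x) (v := qu) (w := q)
    have := hΓ.dist_triangle (u := x) (v := q) (w := p)
    omega
  · refine ⟨u, v, a, γ', b, Γ.dist qv p, by rw [SimpleGraph.Walk.append_assoc], by omega,
      by omega, fun k hk => ?_⟩
    refine le_of_walk_between_cones_aux hΓ hδ (b := qu) (by omega) (by omega) hv (by omega)
      γ'.reverse ?_ (by simpa using hk)
    intro z hz
    rcases hout z (by simpa using hz) with h | h | h
    · exact .inr (.inl h)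
    · exact .inl h
    · refine .inr (.inr fun q hq => hpos y q z h.2 ?_)
      have := hΓ.dist_triangle (u := y) (v := qv) (w := q)
      have := hΓ.dist_triangle (u := y) (v := q) (w := p)
      omega

/-- Exponential beats linear: a `k` of order `s / (8δ + 1)` contradicts the conclusion of
`exists_long_subwalk` unless the subwalk has more than `Ms` edges. -/
theorem exists_two_pow_bound (δ M : ℕ) :
    ∃ s₀ : ℕ, ∀ s, s₀ ≤ s → ∃ k, (M + 1) * s ≤ 2 ^ k ∧ 8 * δ * k + 1 < s := by
  have hlim : Filter.Tendsto (fun k : ℕ => ((k : ℝ) ^ 1 / 2 ^ k)) Filter.atTop (nhds 0) :=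
    tendsto_pow_const_div_const_pow_of_one_lt 1 (by norm_num)
  set b := 8 * δ + 1 with hb
  have hpos : (0 : ℝ) < 1 / (4 * ((M + 1) * b)) := by positivity
  obtain ⟨k₀, hk₀⟩ := Filter.eventually_atTop.1 (hlim.eventually_lt_const hpos)
  -- With `k = s / b - 3` this ensures `k ≥ k₀ + 2`, whence `k + 4 ≤ 4k`.
  refine ⟨b * (k₀ + 5), fun s hs => ?_⟩
  have hsb : k₀ + 5 ≤ s / b := (Nat.le_div_iff_mul_le (by omega)).2 (by rw [mul_comm]; exact hs)
  obtain ⟨k, hk⟩ : ∃ k, s / b = k + 3 := ⟨s / b - 3, by omega⟩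
  have hdiv := Nat.div_add_mod s b
  have hmod := Nat.mod_lt s (show 0 < b by omega)
  rw [hk] at hdiv
  refine ⟨k, ?_, ?_⟩
  · have h := hk₀ k (by omega)
    have hs' : (s : ℝ) ≤ b * (4 * k) := by
      have h1 : s ≤ b * (k + 4) := by nlinarith
      have : s ≤ b * (4 * k) := h1.trans (Nat.mul_le_mul_left _ (by omega))
      exact_mod_cast this
    rw [pow_one, div_lt_div_iff₀ (by positivity) (by positivity)] at h
    have hR : ((M : ℝ) + 1) * s ≤ 2 ^ k := by
      calc ((M : ℝ) + 1) * s ≤ (M + 1) * (b * (4 * k)) := by gcongr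
        _ = k * (4 * ((M + 1) * b)) := by ring
        _ ≤ 2 ^ k := by linarith
    exact_mod_cast hR
  · have : b * (k + 3) = 8 * δ * k + k + 3 * b := by rw [hb]; ring
    omega

end Geometry

/-! ### Counting walks and balls in bounded degree -/

section Counting

variable {V : Type*} {Γ : SimpleGraph V}

/-- Every vertex has at most `D` neighbours. -/
def HasDegreeLE (Γ : SimpleGraph V) (D : ℕ) : Prop :=
  ∀ v, ∃ F : Finset V, F.card ≤ D ∧ ∀ w, Γ.Adj v w → w ∈ F

theorem HasDegreeLE.exists_finset_walks {D : ℕ} (hD : HasDegreeLE Γ D) (m : ℕ) (u : V) :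
    ∃ W : Finset (Σ v, Γ.Walk u v), W.card ≤ D ^ m ∧
      ∀ (v : V) (p : Γ.Walk u v), p.length = m → ⟨v, p⟩ ∈ W := by
  classical
  induction m generalizing u with
  | zero =>
    refine ⟨{⟨u, .nil⟩}, by simp, fun v p hp => ?_⟩
    obtain rfl := SimpleGraph.Walk.eq_of_length_eq_zero hp
    rw [SimpleGraph.Walk.length_eq_zero_iff] at hp
    simp [hp]
  | succ m ih =>
    obtain ⟨F, hF, hadj⟩ := hD u
    choose W hW hmem using ih
    let g : V → Finset (Σ v, Γ.Walk u v) := fun w =>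
      if h : Γ.Adj u w then (W w).image fun q => ⟨q.1, .cons h q.2⟩ else ∅
    refine ⟨F.biUnion g, ?_, fun v p hp => ?_⟩
    · refine (Finset.card_biUnion_le_card_mul F g (D ^ m) fun w _ => ?_).trans ?_
      · by_cases h : Γ.Adj u w
        · simpa [g, h] using Finset.card_image_le.trans (hW w)
        · simp [g, h]
      · rw [pow_succ, mul_comm]
        exact Nat.mul_le_mul_left _ hF
    · cases p with
      | nil => simp at hp
      | @cons _ w _ h p =>
        simp only [Finset.mem_biUnion]
        refine ⟨w, hadj w h, ?_⟩
        simp only [g, h, dif_pos, Finset.mem_image]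
        exact ⟨⟨v, p⟩, hmem w v p (by simpa using hp), rfl⟩

theorem HasDegreeLE.exists_finset_ball {D : ℕ} (hD : HasDegreeLE Γ D) (hΓ : Γ.Connected)
    (r : ℕ) (u : V) :
    ∃ B : Finset V, B.card ≤ (D + 1) ^ r ∧ ∀ v, Γ.dist u v ≤ r → v ∈ B := by
  classical
  induction r generalizing u with
  | zero =>
    refine ⟨{u}, by simp, fun v hv => ?_⟩
    simpa [eq_comm] using hΓ.dist_eq_zero_iff.1 (Nat.le_zero.1 hv)
  | succ r ih =>
    obtain ⟨F, hF, hadj⟩ := hD u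
    choose B hB hmem using ih
    refine ⟨insert u (F.biUnion B), ?_, fun v hv => ?_⟩
    · have h1 := Finset.card_biUnion_le_card_mul F B _ fun w _ => hB w
      have h2 := Nat.mul_le_mul_right ((D + 1) ^ r) hF
      have h3 := Finset.card_insert_le u (F.biUnion B)
      have h4 : 1 ≤ (D + 1) ^ r := Nat.one_le_pow _ _ (by omega)
      rw [pow_succ, Nat.mul_succ, mul_comm _ D]
      omega
    · obtain ⟨p, hp⟩ := hΓ.exists_walk_length_eq_dist u v
      cases p with
      | nil => simp
      | @cons _ w _ h p =>
        rw [SimpleGraph.Walk.length_cons] at hp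
        have := SimpleGraph.dist_le p
        exact Finset.mem_insert_of_mem
          (Finset.mem_biUnion.2 ⟨w, hadj w h, hmem w v (by omega)⟩)

end Counting

/-! ### Large deviations for passage times -/

section Probability

open MeasureTheory

variable {V : Type*} {Γ : SimpleGraph V} (ρ : Measure ℝ≥0) [IsProbabilityMeasure ρ]

/-- The moment generating function of `ρ`, with values in `[0, ∞]`. -/
def expMoment (ρ : Measure ℝ≥0) (t : ℝ) : ℝ≥0∞ :=
  ∫⁻ x : ℝ≥0, ENNReal.ofReal (Real.exp (t * (x : ℝ))) ∂ρ

/-- The edges of a walk, as elements of the edge set. -/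
def edgeList {x y : V} (p : Γ.Walk x y) : List Γ.edgeSet :=
  p.darts.map fun d => ⟨d.edge, d.edge_mem⟩

theorem edgeList_nodup {x y : V} {p : Γ.Walk x y} (hp : p.IsPath) : (edgeList p).Nodup := by
  refine List.Nodup.of_map Subtype.val ?_
  have : (edgeList p).map Subtype.val = p.edges := by
    simp [edgeList, SimpleGraph.Walk.edges, Function.comp_def]
  rw [this]
  exact hp.isTrail.edges_nodup

theorem passageTime_eq_sum {x y : V} {p : Γ.Walk x y} (hp : p.IsPath) [DecidableEq Γ.edgeSet]
    (ω : Config Γ) : passageTime ω p = ∑ e ∈ (edgeList p).toFinset, ω e := by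
  rw [List.sum_toFinset _ (edgeList_nodup hp), passageTime, edgeList, List.map_map]
  rfl

/-- A self-avoiding path uses each edge once, so its passage time is a sum of independent variables.
-/
theorem lintegral_exp_passageTime {x y : V} {p : Γ.Walk x y} (hp : p.IsPath) (t : ℝ) :
    ∫⁻ ω, ENNReal.ofReal (Real.exp (t * (passageTime ω p : ℝ))) ∂(law Γ ρ) =
      expMoment ρ t ^ p.length := by
  classical
  have hm : Measurable fun x : ℝ≥0 => ENNReal.ofReal (Real.exp (t * (x : ℝ))) := by fun_prop
  have hind : ProbabilityTheory.iIndepFun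
      (fun (e : Γ.edgeSet) (ω : Config Γ) => ENNReal.ofReal (Real.exp (t * (ω e : ℝ))))
      (law Γ ρ) :=
    ProbabilityTheory.iIndepFun_infinitePi
      (X := fun _ (x : ℝ≥0) => ENNReal.ofReal (Real.exp (t * (x : ℝ)))) fun _ => hm
  have hint : ∀ e : Γ.edgeSet,
      ∫⁻ ω, ENNReal.ofReal (Real.exp (t * (ω e : ℝ))) ∂(law Γ ρ) = expMoment ρ t := fun e =>
    (measurePreserving_eval_infinitePi (fun _ : Γ.edgeSet => ρ) e).lintegral_comp hm
  have hprod := ProbabilityTheory.lintegral_prod_eq_prod_lintegral_of_indepFun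
    (edgeList p).toFinset _ hind fun e => hm.comp (measurable_pi_apply e)
  have hcard : (edgeList p).toFinset.card = p.length := by
    rw [List.toFinset_card_of_nodup (edgeList_nodup hp)]
    simp [edgeList]
  simp only [hint, Finset.prod_const, hcard] at hprod
  rw [← hprod]
  refine lintegral_congr fun ω => ?_
  rw [passageTime_eq_sum hp, NNReal.coe_sum, Finset.mul_sum, Real.exp_sum,
    ENNReal.ofReal_prod_of_nonneg fun _ _ => (Real.exp_pos _).le]

theorem measurable_passageTime {x y : V} (p : Γ.Walk x y) :
    Measurable fun ω : Config Γ => passageTime ω p := by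
  induction p with
  | nil => simp [passageTime]
  | cons h p ih =>
    simp only [passageTime, SimpleGraph.Walk.darts_cons, List.map_cons, List.sum_cons] at ih ⊢
    exact (measurable_pi_apply _).add ih

/-- Chernoff's bound for the length of a self-avoiding path. -/
theorem law_passageTime_le {x y : V} {p : Γ.Walk x y} (hp : p.IsPath) (t b : ℝ) :
    law Γ ρ {ω | t * b ≤ t * (passageTime ω p : ℝ)} ≤
      ENNReal.ofReal (Real.exp (-(t * b))) * expMoment ρ t ^ p.length := by
  rw [← lintegral_exp_passageTime ρ hp t]
  have hmeas := measurable_passageTime p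
  have hm : Measurable fun ω : Config Γ =>
      ENNReal.ofReal (Real.exp (t * (passageTime ω p : ℝ))) := by fun_prop
  have hmarkov := mul_meas_ge_le_lintegral (μ := law Γ ρ) hm
    (ENNReal.ofReal (Real.exp (t * b)))
  have hset : {ω : Config Γ | ENNReal.ofReal (Real.exp (t * b)) ≤
      ENNReal.ofReal (Real.exp (t * (passageTime ω p : ℝ)))} =
      {ω | t * b ≤ t * (passageTime ω p : ℝ)} := by
    ext ω
    simp [ENNReal.ofReal_le_ofReal_iff (Real.exp_pos _).le]
  rw [hset] at hmarkov
  calc law Γ ρ {ω | t * b ≤ t * (passageTime ω p : ℝ)}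
      = ENNReal.ofReal (Real.exp (-(t * b))) * (ENNReal.ofReal (Real.exp (t * b)) *
          law Γ ρ {ω | t * b ≤ t * (passageTime ω p : ℝ)}) := by
        rw [← mul_assoc, ← ENNReal.ofReal_mul (Real.exp_pos _).le, ← Real.exp_add]
        simp
    _ ≤ _ := by gcongr

theorem tendsto_expMoment (h0 : ρ {0} = 0) :
    Filter.Tendsto (fun k : ℕ => expMoment ρ (-(k : ℝ))) Filter.atTop (nhds 0) := by
  have hlim := tendsto_lintegral_of_dominated_convergence (μ := ρ)
    (F := fun (k : ℕ) (x : ℝ≥0) => ENNReal.ofReal (Real.exp (-(k : ℝ) * (x : ℝ))))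
    (f := fun _ => 0) (fun _ => 1) (fun k => by fun_prop)
    (fun k => Filter.Eventually.of_forall fun x => by
      rw [ENNReal.ofReal_le_one, Real.exp_le_one_iff]
      nlinarith [mul_nonneg (Nat.cast_nonneg (α := ℝ) k) x.coe_nonneg])
    (by simp) ?_
  · simpa [expMoment] using hlim
  · have hne : ∀ᵐ x ∂ρ, x ≠ 0 := by
      rw [ae_iff]
      simpa using h0
    filter_upwards [hne] with x hx
    have hx' : 0 < (x : ℝ) := NNReal.coe_pos.2 (pos_iff_ne_zero.2 hx)
    have h1 : Filter.Tendsto (fun k : ℕ => -(k : ℝ) * (x : ℝ)) Filter.atTop Filter.atBot := by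
      simp only [neg_mul]
      exact Filter.tendsto_neg_atTop_atBot.comp
        (tendsto_natCast_atTop_atTop.atTop_mul_const hx')
    simpa [Function.comp_def] using
      (ENNReal.continuous_ofReal.tendsto 0).comp (Real.tendsto_exp_atBot.comp h1)

variable (Γ) in
/-- Some two points of `N_{2n}(o)` are at first passage distance more than `Kn`. -/
def slowEvent (o : V) (K n : ℕ) : Set (Config Γ) :=
  {ω | ∃ u v : V, Γ.dist o u ≤ 2 * n ∧ Γ.dist o v ≤ 2 * n ∧
    ∀ p : Γ.Walk u v, ((K * n : ℕ) : ℝ) < passageTime ω p}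

variable (Γ) in
/-- Some self-avoiding path of `Mn` edges starting in `N_{2n}(o)` has `ω`-length at most `Kn`. -/
def fastEvent (o : V) (K M n : ℕ) : Set (Config Γ) :=
  {ω | ∃ u v : V, Γ.dist o u ≤ 2 * n ∧ ∃ p : Γ.Walk u v, p.IsPath ∧ p.length = M * n ∧
    (passageTime ω p : ℝ) ≤ (K * n : ℕ)}

theorem exists_law_slowEvent_le (hΓ : Γ.Connected) {D : ℕ} (hD : HasDegreeLE Γ D) (o : V)
    {a : ℝ} (ha : 0 < a) (hρ : expMoment ρ a < ∞) :
    ∃ K : ℕ, ∀ n, law Γ ρ (slowEvent Γ o K n) ≤ ENNReal.ofReal (Real.exp (-1)) ^ n := by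
  -- `A ≥ 1` lets the length of a geodesic in the ball be replaced by its upper bound `4n`.
  obtain ⟨A, hA1, hA⟩ : ∃ A : ℝ, 1 ≤ A ∧ expMoment ρ a ≤ ENNReal.ofReal A :=
    ⟨max 1 (expMoment ρ a).toReal, le_max_left _ _, by
      rw [← ENNReal.ofReal_toReal hρ.ne]
      exact ENNReal.ofReal_le_ofReal (by simp)⟩
  have hβ : (0 : ℝ) < (D : ℝ) + 1 := by positivity
  have hA0 : 0 < A := by linarith
  -- This `K` makes `(D + 1)^4 A^4 e^{-aK} ≤ e^{-1}`, the first factor counting pairs of endpoints.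
  obtain ⟨K, hK⟩ := exists_nat_ge ((1 + Real.log ((D + 1) ^ 4 * A ^ 4)) / a)
  rw [div_le_iff₀ ha] at hK
  refine ⟨K, fun n => ?_⟩
  obtain ⟨B, hB, hmem⟩ := hD.exists_finset_ball hΓ (2 * n) o
  have hsub : slowEvent Γ o K n ⊆ ⋃ u ∈ B, ⋃ v ∈ B,
      {ω | Γ.dist o u ≤ 2 * n ∧ Γ.dist o v ≤ 2 * n ∧
        ∀ p : Γ.Walk u v, ((K * n : ℕ) : ℝ) < passageTime ω p} := by
    rintro ω ⟨u, v, hu, hv, h⟩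
    simp only [Set.mem_iUnion]
    exact ⟨u, hmem u hu, v, hmem v hv, hu, hv, h⟩
  have hone : ∀ u v : V, law Γ ρ {ω | Γ.dist o u ≤ 2 * n ∧ Γ.dist o v ≤ 2 * n ∧
      ∀ p : Γ.Walk u v, ((K * n : ℕ) : ℝ) < passageTime ω p} ≤
        ENNReal.ofReal (Real.exp (-(a * (K * n : ℕ))) * A ^ (4 * n)) := by
    intro u v
    by_cases huv : Γ.dist o u ≤ 2 * n ∧ Γ.dist o v ≤ 2 * n
    · obtain ⟨p, hp, hlen⟩ := hΓ.exists_path_of_dist u v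
      have htri := hΓ.dist_triangle (u := u) (v := o) (w := v)
      rw [SimpleGraph.dist_comm (u := u) (v := o)] at htri
      refine (measure_mono fun ω hω => ?_).trans
        ((law_passageTime_le ρ hp a (K * n : ℕ)).trans ?_)
      · exact mul_le_mul_of_nonneg_left (hω.2.2 p).le ha.le
      · rw [ENNReal.ofReal_mul (Real.exp_pos _).le]
        gcongr
        calc expMoment ρ a ^ p.length ≤ ENNReal.ofReal A ^ p.length := by gcongr
          _ = ENNReal.ofReal (A ^ p.length) := (ENNReal.ofReal_pow hA0.le _).symm
          _ ≤ ENNReal.ofReal (A ^ (4 * n)) :=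
            ENNReal.ofReal_le_ofReal (pow_le_pow_right₀ hA1 (by omega))
    · refine le_of_eq_of_le ?_ zero_le
      convert measure_empty (μ := law Γ ρ)
      ext ω
      simp only [Set.mem_ofPred_eq, Set.mem_empty_iff_false, iff_false]
      tauto
  calc law Γ ρ (slowEvent Γ o K n)
      ≤ ∑ u ∈ B, ∑ v ∈ B, ENNReal.ofReal (Real.exp (-(a * (K * n : ℕ))) * A ^ (4 * n)) := by
        refine (measure_mono hsub).trans ((measure_biUnion_finset_le _ _).trans ?_)
        gcongr with u _
        refine (measure_biUnion_finset_le _ _).trans ?_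
        gcongr with v _
        exact hone u v
    _ = (B.card : ℝ≥0∞) * B.card *
          ENNReal.ofReal (Real.exp (-(a * (K * n : ℕ))) * A ^ (4 * n)) := by
        simp [mul_assoc]
    _ ≤ ENNReal.ofReal ((D + 1) ^ (2 * n)) * ENNReal.ofReal ((D + 1) ^ (2 * n)) *
          ENNReal.ofReal (Real.exp (-(a * (K * n : ℕ))) * A ^ (4 * n)) := by
        have : (B.card : ℝ≥0∞) ≤ ENNReal.ofReal ((D + 1) ^ (2 * n)) := by
          rw [← ENNReal.ofReal_natCast]
          exact ENNReal.ofReal_le_ofReal (by exact_mod_cast hB)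
        gcongr
    _ = ENNReal.ofReal ((((D + 1) ^ 4 * A ^ 4) * Real.exp (-(a * K))) ^ n) := by
        rw [← ENNReal.ofReal_mul (by positivity), ← ENNReal.ofReal_mul (by positivity)]
        congr 1
        rw [mul_pow, mul_pow, ← Real.exp_nat_mul]
        push_cast
        rw [show -(a * (K * n : ℝ)) = n * -(a * K) by ring]
        generalize (D : ℝ) + 1 = β
        ring
    _ ≤ ENNReal.ofReal (Real.exp (-1) ^ n) := by
        refine ENNReal.ofReal_le_ofReal (pow_le_pow_left₀ (by positivity) ?_ n)
        rw [← Real.exp_log (show 0 < ((D : ℝ) + 1) ^ 4 * A ^ 4 by positivity), ← Real.exp_add]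
        exact Real.exp_le_exp.2 (by linarith)
    _ = _ := ENNReal.ofReal_pow (Real.exp_pos _).le _

theorem exists_law_fastEvent_le (hΓ : Γ.Connected) {D : ℕ} (hD : HasDegreeLE Γ D) (o : V)
    (h0 : ρ {0} = 0) (K : ℕ) :
    ∃ M : ℕ, ∀ n, law Γ ρ (fastEvent Γ o K M n) ≤ ENNReal.ofReal (Real.exp (-1)) ^ n := by
  have hβ : (0 : ℝ) < (D : ℝ) + 1 := by positivity
  -- The denominator absorbs the number of choices for each edge, leaving a factor `e^{-1}` per
  -- edge.
  set φ : ℝ := Real.exp (-1) / (D + 1) with hφ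
  have hφ0 : 0 < φ := by positivity
  obtain ⟨l, hl⟩ := ((tendsto_expMoment ρ h0).eventually_lt_const
    (ENNReal.ofReal_pos.2 hφ0)).exists
  obtain ⟨M, hM⟩ := exists_nat_ge (Real.log ((D + 1) ^ 2) + l * K + 1)
  refine ⟨M, fun n => ?_⟩
  obtain ⟨B, hB, hmem⟩ := hD.exists_finset_ball hΓ (2 * n) o
  choose W hW hWmem using hD.exists_finset_walks (M * n)
  have hsub : fastEvent Γ o K M n ⊆ ⋃ u ∈ B, ⋃ p ∈ W u,
      {ω | p.2.IsPath ∧ p.2.length = M * n ∧ (passageTime ω p.2 : ℝ) ≤ (K * n : ℕ)} := by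
    rintro ω ⟨u, v, hu, p, hp, hlen, h⟩
    simp only [Set.mem_iUnion]
    exact ⟨u, hmem u hu, ⟨v, p⟩, hWmem u v p hlen, hp, hlen, h⟩
  have hone : ∀ (u : V) (p : Σ v, Γ.Walk u v),
      law Γ ρ {ω | p.2.IsPath ∧ p.2.length = M * n ∧ (passageTime ω p.2 : ℝ) ≤ (K * n : ℕ)} ≤
        ENNReal.ofReal (Real.exp (l * (K * n : ℕ)) * φ ^ (M * n)) := by
    rintro u ⟨v, p⟩
    by_cases hp : p.IsPath ∧ p.length = M * n
    · refine (measure_mono fun ω hω => ?_).trans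
        ((law_passageTime_le ρ hp.1 (-(l : ℝ)) (K * n : ℕ)).trans ?_)
      · exact mul_le_mul_of_nonpos_left hω.2.2 (by simp)
      · rw [ENNReal.ofReal_mul (Real.exp_pos _).le, hp.2, neg_mul, neg_neg,
          ENNReal.ofReal_pow hφ0.le]
        gcongr
    · refine le_of_eq_of_le ?_ zero_le
      convert measure_empty (μ := law Γ ρ)
      ext ω
      simp only [Set.mem_ofPred_eq, Set.mem_empty_iff_false, iff_false]
      tauto
  calc law Γ ρ (fastEvent Γ o K M n)
      ≤ ∑ u ∈ B, ∑ p ∈ W u, ENNReal.ofReal (Real.exp (l * (K * n : ℕ)) * φ ^ (M * n)) := by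
        refine (measure_mono hsub).trans ((measure_biUnion_finset_le _ _).trans ?_)
        gcongr with u _
        refine (measure_biUnion_finset_le _ _).trans ?_
        gcongr with p _
        exact hone u p
    _ ≤ ∑ u ∈ B, ENNReal.ofReal ((D + 1) ^ (M * n)) *
          ENNReal.ofReal (Real.exp (l * (K * n : ℕ)) * φ ^ (M * n)) := by
        gcongr with u _
        rw [Finset.sum_const, nsmul_eq_mul, ← ENNReal.ofReal_natCast]
        gcongr
        have h1 : ((W u).card : ℝ) ≤ (D : ℝ) ^ (M * n) := by exact_mod_cast hW u
        exact h1.trans (pow_le_pow_left₀ (by positivity) (by linarith) _)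
    _ ≤ ENNReal.ofReal ((D + 1) ^ (2 * n)) * (ENNReal.ofReal ((D + 1) ^ (M * n)) *
          ENNReal.ofReal (Real.exp (l * (K * n : ℕ)) * φ ^ (M * n))) := by
        rw [Finset.sum_const, nsmul_eq_mul, ← ENNReal.ofReal_natCast]
        gcongr
        exact_mod_cast hB
    _ = ENNReal.ofReal (((D + 1) ^ 2 * Real.exp (l * K) * Real.exp (-M)) ^ n) := by
        rw [← ENNReal.ofReal_mul (by positivity), ← ENNReal.ofReal_mul (by positivity)]
        congr 1
        have h1 : ((D : ℝ) + 1) ^ (M * n) * φ ^ (M * n) = Real.exp (-M) ^ n := by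
          rw [← mul_pow, hφ, mul_div_cancel₀ _ hβ.ne', pow_mul, ← Real.exp_nat_mul]
          simp
        rw [mul_pow, mul_pow, ← h1, ← Real.exp_nat_mul (l * K : ℝ) n]
        push_cast
        rw [show (l : ℝ) * (K * n) = n * (l * K) by ring]
        generalize (D : ℝ) + 1 = β
        ring
    _ ≤ ENNReal.ofReal (Real.exp (-1) ^ n) := by
        refine ENNReal.ofReal_le_ofReal (pow_le_pow_left₀ (by positivity) ?_ n)
        rw [← Real.exp_log (show 0 < ((D : ℝ) + 1) ^ 2 by positivity), ← Real.exp_add,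
          ← Real.exp_add]
        exact Real.exp_le_exp.2 (by linarith)
    _ = _ := ENNReal.ofReal_pow (Real.exp_pos _).le _

end Probability

/-! ### Configurations outside the exceptional events -/

section Deterministic

variable {V : Type*} {Γ : SimpleGraph V}

theorem passageTime_append (ω : Config Γ) {x y z : V} (p : Γ.Walk x y) (q : Γ.Walk y z) :
    passageTime ω (p.append q) = passageTime ω p + passageTime ω q := by
  simp [passageTime, SimpleGraph.Walk.darts_append]

theorem passageTime_bypass_le [DecidableEq V] (ω : Config Γ) {x y : V} (p : Γ.Walk x y) :
    passageTime ω p.bypass ≤ passageTime ω p :=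
  (p.darts_bypass_sublist_darts.map _).sum_le_sum fun _ _ => zero_le

theorem isOmegaGeodesic_iff {ω : Config Γ} {x y : V} {p : Γ.Walk x y} :
    IsOmegaGeodesic ω p ↔ ∀ q : Γ.Walk x y, passageTime ω p ≤ passageTime ω q := by
  have : Nonempty (Γ.Walk x y) := ⟨p⟩
  refine ⟨fun h q => h.trans_le (ciInf_le (OrderBot.bddBelow _) q), fun h => ?_⟩
  exact le_antisymm (le_ciInf h) (ciInf_le (OrderBot.bddBelow _) p)

theorem IsOmegaGeodesic.subwalk {ω : Config Γ} {x u v y : V} {a : Γ.Walk x u} {p : Γ.Walk u v}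
    {b : Γ.Walk v y} (h : IsOmegaGeodesic ω (a.append (p.append b))) : IsOmegaGeodesic ω p := by
  rw [isOmegaGeodesic_iff] at h ⊢
  intro q
  have := h (a.append (q.append b))
  simpa [passageTime_append] using this

/-- Self-avoiding paths with at least `Mn` edges have `ω`-length more than `Kn` outside of the
fast event. -/
theorem lt_passageTime_of_notMem_fastEvent {o : V} {K M n : ℕ} {ω : Config Γ}
    (hω : ω ∉ fastEvent Γ o K M n) {u v : V} (hu : Γ.dist o u ≤ 2 * n) {p : Γ.Walk u v}
    (hp : p.IsPath) (hlen : M * n ≤ p.length) :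
    ((K * n : ℕ) : ℝ) < passageTime ω p := by
  obtain ⟨z, a, b, ha, rfl⟩ := exists_eq_append_of_le p _ hlen
  by_contra! hle
  refine hω ⟨u, z, hu, a, hp.of_append_left, ha, le_trans ?_ hle⟩
  rw [passageTime_append]
  simp

/-- Erasing loops does not increase passage time, and self-avoiding competitors have at most `Mn`
edges; the infimum reduces to a minimum over a finite set. -/
theorem exists_isOmegaGeodesic {D : ℕ} (hD : HasDegreeLE Γ D) {o : V} {K M n : ℕ} {ω : Config Γ}
    (hslow : ω ∉ slowEvent Γ o K n) (hfast : ω ∉ fastEvent Γ o K M n) {x y : V}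
    (hx : Γ.dist o x ≤ 2 * n) (hy : Γ.dist o y ≤ 2 * n) :
    ∃ q : Γ.Walk x y, IsOmegaGeodesic ω q := by
  classical
  obtain ⟨p, hp⟩ : ∃ p : Γ.Walk x y, (passageTime ω p : ℝ) ≤ (K * n : ℕ) := by
    by_contra! h
    exact hslow ⟨x, y, hx, hy, h⟩
  have hshort : ∀ q : Γ.Walk x y, passageTime ω q ≤ passageTime ω p →
      q.bypass.length ≤ M * n := by
    intro q hq
    by_contra! h
    have h1 := lt_passageTime_of_notMem_fastEvent hfast hx q.bypass_isPath h.le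
    have h2 : (passageTime ω q.bypass : ℝ) ≤ passageTime ω p :=
      NNReal.coe_le_coe.2 ((passageTime_bypass_le ω q).trans hq)
    linarith
  have hfin : {q : Γ.Walk x y | q.length ≤ M * n}.Finite := by
    choose W _ hW using fun m => hD.exists_finset_walks m x
    refine ((((Finset.range (M * n + 1)).biUnion W).finite_toSet).preimage
      (sigma_mk_injective (i := y)).injOn).subset fun q hq => ?_
    simp only [Set.mem_preimage, Finset.mem_coe, Finset.mem_biUnion, Finset.mem_range]
    exact ⟨q.length, Nat.lt_succ_of_le hq, hW _ _ q rfl⟩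
  obtain ⟨q, -, hq⟩ := Set.exists_min_image _ (passageTime ω) hfin ⟨p.bypass, hshort p le_rfl⟩
  refine ⟨q, isOmegaGeodesic_iff.2 fun r => ?_⟩
  rcases le_total (passageTime ω r) (passageTime ω p) with h | h
  · exact (hq _ (hshort r h)).trans (passageTime_bypass_le ω r)
  · exact ((hq _ (hshort p le_rfl)).trans (passageTime_bypass_le ω p)).trans h

theorem goodRadius_of_notMem_events (hΓ : Γ.Connected) {δ : ℕ} (hδ : IsSlim Γ δ) {D : ℕ}
    (hD : HasDegreeLE Γ D) {o : V} {C : ℝ} {c K M n₀ R : ℕ} {ω : Config Γ} (hC : C ≤ c)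
    (hslow : ∀ n, n₀ ≤ n → ω ∉ slowEvent Γ o K n)
    (hfast : ∀ n, n₀ ≤ n → ω ∉ fastEvent Γ o K M n)
    (hpow : ∀ s, n₀ ≤ s → ∃ k, (M + 1) * s ≤ 2 ^ k ∧ 8 * δ * k + 1 < s)
    (hc : 4 * c ≤ 3 * n₀) (hR : 5 * n₀ + 4 * c ≤ 4 * (R + 1)) :
    GoodRadius o C ω R := by
  classical
  rintro x y ⟨w, hw, p, hpw, hop⟩
  refine ⟨?_, fun q hq => ?_⟩
  -- Every pair of endpoints is covered because all scales beyond `n₀` are controlled.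
  · set n := max n₀ (max (Γ.dist o x) (Γ.dist o y))
    exact exists_isOmegaGeodesic hD (hslow n (by omega)) (hfast n (by omega))
      (by omega) (by omega)
  · by_contra hmeet
    have hop' : Γ.dist o p ≤ c := by exact_mod_cast hop.trans hC
    have hfar : ∀ z ∈ q.bypass.support, R < Γ.dist o z := by
      intro z hz
      by_contra! hle
      exact hmeet ⟨z, q.support_bypass_subset_support hz, by exact_mod_cast hle⟩
    have hgeo : IsOmegaGeodesic ω q.bypass :=
      isOmegaGeodesic_iff.2 fun r =>
        (passageTime_bypass_le ω q).trans (isOmegaGeodesic_iff.1 hq r)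
    have hp : Γ.dist x p + Γ.dist p y = Γ.dist x y := by
      obtain ⟨w₁, w₂, rfl⟩ := SimpleGraph.Walk.mem_support_iff_exists_append.1 hpw
      rw [IsWordGeodesic, SimpleGraph.Walk.length_append] at hw
      have := SimpleGraph.dist_le w₁
      have := SimpleGraph.dist_le w₂
      have := hΓ.dist_triangle (u := x) (v := p) (w := y)
      omega
    obtain ⟨u, v, a, γ, b, s, hγ, hu, hv, hlong⟩ := exists_long_subwalk hΓ hδ hp q.bypass
    have hRu := hfar u (by simp [hγ, SimpleGraph.Walk.mem_support_append_iff])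
    have hpath := q.bypass_isPath
    rw [hγ] at hgeo hpath
    have tu := hΓ.dist_triangle (u := o) (v := p) (w := u)
    have tv := hΓ.dist_triangle (u := o) (v := p) (w := v)
    -- Avoiding `N_R(o)` forces `R + 1 ≤ c + 5s/4`. Then `4c ≤ 3s`, so `u` and `v` lie in
    -- `N_{2s}(o)`.
    have hs : n₀ ≤ s := by omega
    obtain ⟨k, hk1, hk2⟩ := hpow s hs
    have hlen : M * s ≤ γ.length := by
      by_contra! h
      have := hlong k (by rw [Nat.succ_mul] at hk1; omega)
      omega
    -- The long subwalk costs more than `Ks`, yet is itself `ω`-geodesic, so every walk from `u` to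
    -- `v` costs more.
    refine hslow s hs ⟨u, v, by omega, by omega, fun r => ?_⟩
    exact (lt_passageTime_of_notMem_fastEvent (hfast s hs) (by omega)
      hpath.of_append_right.of_append_left hlen).trans_le
        (NNReal.coe_le_coe.2 (isOmegaGeodesic_iff.1 hgeo.subwalk r))

theorem lt_radius_of_goodRadius {o : V} {C : ℝ} {ω : Config Γ} {N : ℕ} (hN : 1 ≤ N)
    (h : GoodRadius o C ω (N - 1)) : ¬ (N : ℕ∞) ≤ radius o C ω := by
  intro hle
  have h1 : radius o C ω ≤ ((N - 1 : ℕ) : ℕ∞) := sInf_le ⟨N - 1, rfl, h⟩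
  have h2 : N ≤ N - 1 := by exact_mod_cast hle.trans h1
  omega

end Deterministic

/-! ### Summation over scales and conclusion -/

theorem tsum_exp_neg_one_pow_le (n₀ : ℕ) :
    ∑' n : ℕ, 2 * ENNReal.ofReal (Real.exp (-1)) ^ (n₀ + n) ≤
      ENNReal.ofReal (Real.exp (2 - n₀)) := by
  have he : (2 : ℝ) ≤ Real.exp 1 := by linarith [Real.add_one_le_exp (1 : ℝ)]
  have hhalf : Real.exp (-1) ≤ 1 / 2 := by
    rw [Real.exp_neg, one_div]
    exact inv_anti₀ (by norm_num) he
  have hsum : HasSum (fun n : ℕ => 2 * Real.exp (-1) ^ (n₀ + n))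
      (2 * Real.exp (-1) ^ n₀ * (1 - Real.exp (-1))⁻¹) := by
    have := (hasSum_geometric_of_lt_one (Real.exp_pos (-1)).le (by linarith)).mul_left
      (2 * Real.exp (-1) ^ n₀)
    simpa [pow_add, mul_assoc] using this
  have hterm : ∀ n : ℕ, 2 * ENNReal.ofReal (Real.exp (-1)) ^ (n₀ + n) =
      ENNReal.ofReal (2 * Real.exp (-1) ^ (n₀ + n)) := fun n => by
    rw [ENNReal.ofReal_mul (by norm_num), ENNReal.ofReal_pow (Real.exp_pos _).le]
    simp
  simp_rw [hterm]
  rw [← ENNReal.ofReal_tsum_of_nonneg (fun n => by positivity) hsum.summable, hsum.tsum_eq]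
  refine ENNReal.ofReal_le_ofReal ?_
  have hinv : (1 - Real.exp (-1))⁻¹ ≤ 2 := by
    rw [inv_le_comm₀ (by linarith) (by norm_num)]
    linarith
  have hsq : (4 : ℝ) ≤ Real.exp 2 := by
    rw [show (2 : ℝ) = 1 + 1 by norm_num, Real.exp_add]
    nlinarith
  have hpow : Real.exp (-1) ^ n₀ = Real.exp (-n₀) := by
    rw [← Real.exp_nat_mul]
    simp
  calc 2 * Real.exp (-1) ^ n₀ * (1 - Real.exp (-1))⁻¹ ≤ 2 * Real.exp (-1) ^ n₀ * 2 := by gcongr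
    _ = 4 * Real.exp (-n₀) := by rw [hpow]; ring
    _ ≤ Real.exp 2 * Real.exp (-n₀) := by gcongr
    _ = Real.exp (2 - n₀) := by rw [← Real.exp_add, sub_eq_add_neg]

open MeasureTheory in
/-- Exponential tails for the radius in a hyperbolic graph of bounded degree. -/
theorem exists_law_le_radius_le {V : Type*} {Γ : SimpleGraph V} (hΓ : IsGromovHyperbolic Γ)
    {D : ℕ} (hD : HasDegreeLE Γ D) (ρ : Measure ℝ≥0) [IsProbabilityMeasure ρ] (h0 : ρ {0} = 0)
    {a : ℝ} (ha : 0 < a) (hρ : expMoment ρ a < ∞) (o : V) (C : ℝ) :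
    ∃ (c : ℝ) (N₀ : ℕ), 0 < c ∧ ∀ N : ℕ, N₀ ≤ N →
      law Γ ρ {ω | (N : ℕ∞) ≤ radius o C ω} ≤ ENNReal.ofReal (Real.exp (-c * N)) := by
  obtain ⟨hconn, δ, hδ⟩ := hΓ
  obtain ⟨K, hK⟩ := exists_law_slowEvent_le ρ hconn hD o ha hρ
  obtain ⟨M, hM⟩ := exists_law_fastEvent_le ρ hconn hD o h0 K
  obtain ⟨s₀, hs₀⟩ := exists_two_pow_bound δ M
  obtain ⟨c, hc⟩ := exists_nat_ge C
  -- With `n₀ = N / 2`, the series is at most `e^{2 - n₀}`, which is below `e^{-N/4}` for `N ≥ 10`;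
  -- the other terms secure `n₀ ≥ s₀` and the inequalities involving `c` for `R = N - 1`.
  refine ⟨1 / 4, 10 + 2 * s₀ + 3 * c, by norm_num, fun N hN => ?_⟩
  set n₀ := N / 2 with hn₀
  have hsub : {ω : Config Γ | (N : ℕ∞) ≤ radius o C ω} ⊆
      ⋃ n : ℕ, slowEvent Γ o K (n₀ + n) ∪ fastEvent Γ o K M (n₀ + n) := by
    intro ω hω
    by_contra hcon
    simp only [Set.mem_iUnion, Set.mem_union, not_exists, not_or] at hcon
    refine lt_radius_of_goodRadius (by omega) ?_ hω
    refine goodRadius_of_notMem_events hconn hδ hD (K := K) (M := M) (n₀ := n₀) hc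
      (fun n hn => ?_) (fun n hn => ?_) (fun s hs => hs₀ s (by omega)) (by omega) (by omega)
    · simpa [Nat.add_sub_cancel' hn] using (hcon (n - n₀)).1
    · simpa [Nat.add_sub_cancel' hn] using (hcon (n - n₀)).2
  calc law Γ ρ {ω | (N : ℕ∞) ≤ radius o C ω}
      ≤ ∑' n : ℕ, law Γ ρ (slowEvent Γ o K (n₀ + n) ∪ fastEvent Γ o K M (n₀ + n)) :=
        (measure_mono hsub).trans (measure_iUnion_le _)
    _ ≤ ∑' n : ℕ, 2 * ENNReal.ofReal (Real.exp (-1)) ^ (n₀ + n) := by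
        refine ENNReal.tsum_le_tsum fun n => (measure_union_le _ _).trans ?_
        rw [two_mul]
        exact add_le_add (hK _) (hM _)
    _ ≤ ENNReal.ofReal (Real.exp (2 - n₀)) := tsum_exp_neg_one_pow_le n₀
    _ ≤ ENNReal.ofReal (Real.exp (-(1 / 4) * N)) := by
        refine ENNReal.ofReal_le_ofReal (Real.exp_le_exp.2 ?_)
        have h1 : (N : ℝ) ≤ 2 * n₀ + 1 := by exact_mod_cast (by omega : N ≤ 2 * n₀ + 1)
        have h2 : (10 : ℝ) ≤ N := by exact_mod_cast (by omega : 10 ≤ N)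
        linarith

theorem hasDegreeLE_mulCayley {G : Type*} [Group G] (S : Finset G) (hS : ∀ s ∈ S, s⁻¹ ∈ S) :
    HasDegreeLE (SimpleGraph.mulCayley (S : Set G)) S.card := by
  classical
  refine fun v => ⟨S.image (v * ·), Finset.card_image_le, fun w hw => ?_⟩
  rw [SimpleGraph.mulCayley_adj] at hw
  refine Finset.mem_image.2 ⟨v⁻¹ * w, ?_, by simp⟩
  rcases hw.2 with h | h
  · exact h
  · simpa using hS _ h

end FPP

end

theorem proposition2p1 {G : Type*} [Group G] (S : Finset G)
    (hG : IsNonelementaryHyperbolic G S)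
    (ρ : MeasureTheory.Measure ℝ≥0) [MeasureTheory.IsProbabilityMeasure ρ]
    (hatom : ∀ t : ℝ≥0, ρ {t} = 0)
    (hρ : ∃ a : ℝ, 0 < a ∧ ∫⁻ t : ℝ≥0, ENNReal.ofReal (Real.exp (a * (t : ℝ))) ∂ρ < ∞)
    (o : G) (C : ℝ) (hC : 0 < C) :
    ∃ (c : ℝ) (N₀ : ℕ), 0 < c ∧ ∀ N : ℕ, N₀ ≤ N →
      FPP.law (SimpleGraph.mulCayley (S : Set G)) ρ
          {ω | (N : ℕ∞) ≤ FPP.radius o C ω}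
        ≤ ENNReal.ofReal (Real.exp (-c * N)) := by
  obtain ⟨a, ha, hexp⟩ := hρ
  exact FPP.exists_law_le_radius_le hG.hyperbolic (FPP.hasDegreeLE_mulCayley S hG.symmetric) ρ
    (hatom 0) ha hexp o C
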